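/- Let $k$ be a field, $n\ge 0$, and $R=S=k[y_0,\dots,y_n]$ with its standard grading and $\mathfrak m=(y_0,\dots,y_n)$. For an ideal $J$ of $R$ and an integer $m\ge 0$, the $m$-th symbolic power of $J$ is $$J^{(m)}=R\cap\bigcap_{P\in \mathrm{Ass}(R/J)} J^mR_P,$$ where $R\cap J^mR_P$ is the preimage of $J^mR_P$ under $R\to R_P$ (an empty intersection is $R$). A homogeneous ideal $J$ is saturated if $J:\mathfrak m^N\subseteq J$ for all $N$. Call $J$ an ideal of points if it is homogeneous and saturated and its zero locus in $\mathbb P^n_k=\mathrm{Proj}\,R$ has dimension $0$ (in particular is non-empty). Let $I\subseteq S$ be an ideal of points. Let $f_0,\dots,f_n\in R$ be an $R$-regular sequence of homogeneous polynomials of the same degree, let $\varphi:S\to R$ be the $k$-algebra homomorphism with $y_i\mapsto f_i$, and let $\varphi_*(I)$ be the ideal of $R$ generated by $\varphi(I)$. 1. For all integers $m,r\ge 0$, $I^{(m)}\subseteq I^r$ if and only if $\varphi_*(I)^{(m)}\subseteq\varphi_*(I)^r$. 2. Consequently, counterexamples to the containment $J^{(nr-n+1)}\subseteq J^r$ for ideals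 of points pull back to counterexamples: if $r\ge 1$ and $I^{(nr-n+1)}\not\subseteq I^r$, then $\varphi_*(I)$ is again an ideal of points, and $\varphi_*(I)^{(nr-n+1)}\not\subseteq\varphi_*(I)^r$. -/

import Mathlib

/-- The `m`-th symbolic power `I^(m) = R ∩ ⋂_{P ∈ Ass(R/I)} I^m R_P` of an ideal `I`, where
`R ∩ I^m R_P` is the preimage of the extended ideal `I^m R_P` under `R → R_P`. -/
noncomputable def symbolicPower {R : Type*} [CommRing R] (I : Ideal R) (m : ℕ) : Ideal R :=
  ⨅ P : associatedPrimes R (R ⧸ I),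
    ((I ^ m).map (algebraMap R (Localization.AtPrime P.1))).comap
      (algebraMap R (Localization.AtPrime P.1))

/-- The homogeneous coordinate ring `k[y_0, …, y_n]` of `ℙⁿ` over `k`. -/
abbrev CoordRing (k : Type*) [Field k] (n : ℕ) : Type _ := MvPolynomial (Fin (n + 1)) k

/-- The standard grading of `k[y_0, …, y_n]` by total degree. -/
noncomputable abbrev stdGrading (k : Type*) [Field k] (n : ℕ) :
    ℕ → Submodule k (CoordRing k n) :=
  MvPolynomial.homogeneousSubmodule (Fin (n + 1)) k

attribute [local instance] MvPolynomial.gradedAlgebra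

/-- `I` is saturated with respect to the irrelevant ideal `𝔪 = (y_0, …, y_n)`:
`I : 𝔪^N ⊆ I` for every `N`. -/
def IsSaturatedIdeal {k : Type*} [Field k] {n : ℕ} (I : Ideal (CoordRing k n)) : Prop :=
  ∀ (N : ℕ) (g : CoordRing k n),
    (∀ h ∈ Ideal.span (Set.range (MvPolynomial.X (R := k) (σ := Fin (n + 1)))) ^ N, h * g ∈ I) →
      g ∈ I

/-- The zero locus `V(I)` of `I` in `ℙⁿ_k = Proj k[y_0, …, y_n]`, with the Zariski topology, has
dimension `0` (in particular it is not empty). -/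
def HasZeroDimLocus {k : Type*} [Field k] {n : ℕ} (I : Ideal (CoordRing k n)) : Prop :=
  topologicalKrullDim
    (ProjectiveSpectrum.zeroLocus (stdGrading k n) (I : Set (CoordRing k n))) = 0

/-- `I` is a saturated homogeneous ideal of `k[y_0, …, y_n]` whose zero locus in `ℙⁿ` is
`0`-dimensional. -/
structure IsIdealOfPoints {k : Type*} [Field k] {n : ℕ} (I : Ideal (CoordRing k n)) : Prop where
  homogeneous : I.IsHomogeneous (stdGrading k n)
  saturated : IsSaturatedIdeal I
  zeroDim : HasZeroDimLocus I

/-- The ideal `φ_*(I)` generated by `φ(I)`, where `φ` is the `k`-algebra endomorphism of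
`k[y_0, …, y_n]` with `y_i ↦ f_i`. -/
noncomputable def pushIdeal {k : Type*} [Field k] {n : ℕ} (f : Fin (n + 1) → CoordRing k n)
    (I : Ideal (CoordRing k n)) : Ideal (CoordRing k n) :=
  Ideal.span (MvPolynomial.aeval (R := k) f '' (I : Set (CoordRing k n)))

/-! The point is that `φ` makes `R` a nonzero finite free `S`-module. A regular sequence of `n + 1`
elements cuts `R` down to a finite-dimensional algebra, and monomials forming a `k`-basis of it are
an `S`-basis of `R`: they generate by graded Nakayama, and they are independent because the sequence
is regular (`exists_basis_of_isRegular`).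

For a finite free map, lying in an extended ideal is a condition on coordinates. So extension of
ideals reflects inclusions, and with lying over and incomparability it commutes with symbolic powers
(`symbolicPower_map`). It commutes with ordinary powers too, so both containments are equivalent.

Saturation also passes through coordinates, and zero-dimensionality of the locus through lying over
and incomparability for homogeneous primes (`IsIdealOfPoints.map_aeval`). -/

theorem mem_symbolicPower_iff {R : Type*} [CommRing R] {I : Ideal R} {m : ℕ} {x : R} :
    x ∈ symbolicPower I m ↔
      ∀ P ∈ associatedPrimes R (R ⧸ I), ∃ s ∉ P, s * x ∈ I ^ m := by
  simp only [symbolicPower, Ideal.mem_iInf, Subtype.forall, Ideal.mem_comap]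
  refine forall₂_congr fun P hP => ?_
  have : P.IsPrime := hP.isPrime
  rw [IsLocalization.algebraMap_mem_map_algebraMap_iff P.primeCompl]
  rfl

theorem isAssociatedPrime_quotient_iff {R : Type*} [CommRing R] [IsNoetherianRing R]
    {I P : Ideal R} :
    P ∈ associatedPrimes R (R ⧸ I) ↔ P.IsPrime ∧ ∃ x : R, ∀ r, r ∈ P ↔ r * x ∈ I := by
  rw [AssociatedPrimes.mem_iff, isAssociatedPrime_iff]
  refine and_congr_right fun _ => ⟨?_, ?_⟩
  · rintro ⟨x, hx⟩
    obtain ⟨x, rfl⟩ := Ideal.Quotient.mk_surjective x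
    refine ⟨x, fun r => ?_⟩
    rw [hx, Submodule.mem_colon_singleton, Submodule.mem_bot, ← Ideal.Quotient.eq_zero_iff_mem,
      map_mul]
    rfl
  · rintro ⟨x, hx⟩
    refine ⟨Ideal.Quotient.mk I x, Ideal.ext fun r => ?_⟩
    rw [hx, Submodule.mem_colon_singleton, Submodule.mem_bot, ← Ideal.Quotient.eq_zero_iff_mem,
      map_mul]
    rfl

/-- In a Noetherian ring, the conductor of `x ∉ I` into `I` lies in an associated prime. -/
theorem exists_associatedPrime_of_notMem {R : Type*} [CommRing R] [IsNoetherianRing R]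
    {I : Ideal R} {x : R} (hx : x ∉ I) :
    ∃ P ∈ associatedPrimes R (R ⧸ I), ∀ r, r * x ∈ I → r ∈ P := by
  obtain ⟨P, hP, hle⟩ := exists_le_isAssociatedPrime_of_isNoetherianRing R
    (Ideal.Quotient.mk I x) (by rwa [Ne, Ideal.Quotient.eq_zero_iff_mem])
  refine ⟨P, hP, fun r hr => hle ?_⟩
  rw [Submodule.mem_colon_singleton, Submodule.mem_bot]
  rw [← Ideal.Quotient.eq_zero_iff_mem, map_mul] at hr
  exact hr

/-! ### Extension of ideals along free algebras. -/

section Free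

variable {A B ι : Type*} [CommRing A] [CommRing B] [Algebra A B]

/-- Membership in an extended ideal is read off from the coordinates in a basis. -/
theorem Module.Basis.mem_ideal_map_iff (b : Module.Basis ι A B) {J : Ideal A} {x : B} :
    x ∈ J.map (algebraMap A B) ↔ ∀ i, b.repr x i ∈ J := by
  constructor
  · intro hx i
    rw [Ideal.map] at hx
    refine Submodule.span_induction (p := fun x _ => ∀ i, b.repr x i ∈ J) ?_ ?_ ?_ ?_ hx i
    · rintro _ ⟨a, ha, rfl⟩ i
      rw [Algebra.algebraMap_eq_smul_one, map_smul]
      exact J.mul_mem_right _ ha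
    · simp
    · intro x y _ _ h1 h2 i
      simpa using J.add_mem (h1 i) (h2 i)
    · intro r x _ h i
      rw [← b.linearCombination_repr x, Finsupp.linearCombination_apply, Finsupp.sum,
        smul_eq_mul, Finset.mul_sum, map_sum, Finsupp.finsetSum_apply]
      refine J.sum_mem fun j _ => ?_
      rw [mul_smul_comm, map_smul]
      exact J.mul_mem_right _ (h j)
  · intro h
    rw [← b.linearCombination_repr x, Finsupp.linearCombination_apply, Finsupp.sum]
    refine Ideal.sum_mem _ fun j _ => ?_
    rw [Algebra.smul_def]
    exact Ideal.mul_mem_right _ _ (Ideal.mem_map_of_mem _ (h j))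

theorem Module.Basis.algebraMap_mul_mem_ideal_map_iff (b : Module.Basis ι A B) {J : Ideal A}
    {a : A} {x : B} :
    algebraMap A B a * x ∈ J.map (algebraMap A B) ↔ ∀ i, a * b.repr x i ∈ J := by
  rw [b.mem_ideal_map_iff, ← Algebra.smul_def]
  simp

variable [IsNoetherianRing A] [IsNoetherianRing B]

/-- If `Q` is the conductor of `x`, some coordinate of `x` lies outside `I`, and every element of
`A` lying in `Q` multiplies that coordinate into `I`. -/
theorem Module.Basis.exists_comap_le_associatedPrime (b : Module.Basis ι A B) {I : Ideal A}
    {Q : Ideal B} (hQ : Q ∈ associatedPrimes B (B ⧸ I.map (algebraMap A B))) :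
    ∃ P ∈ associatedPrimes A (A ⧸ I), Q.comap (algebraMap A B) ≤ P := by
  obtain ⟨hp, x, hx⟩ := isAssociatedPrime_quotient_iff.1 hQ
  have h1 : x ∉ I.map (algebraMap A B) := fun h => hp.one_notMem ((hx 1).2 (by simpa using h))
  rw [b.mem_ideal_map_iff] at h1
  push Not at h1
  obtain ⟨i, hi⟩ := h1
  obtain ⟨P, hP, hle⟩ := exists_associatedPrime_of_notMem hi
  refine ⟨P, hP, fun a ha => hle a ?_⟩
  exact b.algebraMap_mul_mem_ideal_map_iff.1 ((hx _).1 ha) i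

/-- For an integral free extension, all primes over an associated prime are associated primes of
the extended ideal. -/
theorem Module.Basis.mem_associatedPrimes_of_comap_mem [Algebra.IsIntegral A B]
    (b : Module.Basis ι A B) {I : Ideal A} {Q : Ideal B} [hQ : Q.IsPrime]
    (h : Q.comap (algebraMap A B) ∈ associatedPrimes A (A ⧸ I)) :
    Q ∈ associatedPrimes B (B ⧸ I.map (algebraMap A B)) := by
  obtain ⟨hp, s, hs⟩ := isAssociatedPrime_quotient_iff.1 h
  -- Incomparability: no prime strictly below `Q` has the same contraction.
  have hmin : Q ∈ ((Q.comap (algebraMap A B)).map (algebraMap A B)).minimalPrimes := by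
    refine ⟨⟨hQ, Ideal.map_comap_le⟩, fun Q' ⟨hQ', hle⟩ hle' => ?_⟩
    by_contra hlt
    have := Ideal.IsIntegral.comap_lt_comap (R := A) (lt_of_le_not_ge hle' hlt)
    exact this.not_ge (Ideal.map_le_iff_le_comap.1 hle)
  have hass : Q ∈ associatedPrimes B (B ⧸ (Q.comap (algebraMap A B)).map (algebraMap A B)) := by
    apply Module.associatedPrimes.minimalPrimes_annihilator_subset_associatedPrimes
    rwa [Ideal.annihilator_quotient]
  obtain ⟨-, x, hx⟩ := isAssociatedPrime_quotient_iff.1 hass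
  -- With `P` the contraction of `Q`: `s` has conductor `P` into `I` and `x` has conductor `Q` into
  -- `PB`, so coordinatewise `s * x` has conductor `Q` into `IB`.
  refine isAssociatedPrime_quotient_iff.2 ⟨hQ, algebraMap A B s * x, fun r => ?_⟩
  rw [hx, mul_left_comm, b.algebraMap_mul_mem_ideal_map_iff, b.mem_ideal_map_iff]
  simp_rw [hs, mul_comm s]

/-- Symbolic powers commute with integral free base change. -/
theorem Module.Basis.symbolicPower_map [Algebra.IsIntegral A B] (b : Module.Basis ι A B)
    (I : Ideal A) (m : ℕ) :
    symbolicPower (I.map (algebraMap A B)) m = (symbolicPower I m).map (algebraMap A B) := by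
  apply le_antisymm
  · intro x hx
    rw [b.mem_ideal_map_iff]
    intro i
    rw [mem_symbolicPower_iff] at hx ⊢
    intro P hP
    have hPp : P.IsPrime := hP.isPrime
    -- If the conductor `J` of `x` contracted into `P`, lying over would give a prime `Q ⊇ J` above
    -- `P`. Such a `Q` is associated to `IB`, against `x` being in the symbolic power.
    set J : Ideal B := ((I.map (algebraMap A B)) ^ m).colon {x} with hJ
    have hnot : ¬ J.comap (algebraMap A B) ≤ P := by
      intro hle
      obtain ⟨Q, hJQ, hQ, hQP⟩ := Ideal.exists_ideal_over_prime_of_isIntegral P J hle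
      obtain ⟨s, hs, hsx⟩ := hx Q (b.mem_associatedPrimes_of_comap_mem (hQP ▸ hP))
      exact hs (hJQ (Submodule.mem_colon_singleton.2 hsx))
    obtain ⟨s, hs, hsP⟩ := SetLike.not_le_iff_exists.1 hnot
    refine ⟨s, hsP, ?_⟩
    rw [Ideal.mem_comap, hJ, Submodule.mem_colon_singleton, ← Ideal.map_pow, smul_eq_mul,
      b.algebraMap_mul_mem_ideal_map_iff] at hs
    exact hs i
  · refine Ideal.map_le_iff_le_comap.2 fun x hx => ?_
    rw [Ideal.mem_comap, mem_symbolicPower_iff]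
    rw [mem_symbolicPower_iff] at hx
    intro Q hQ
    obtain ⟨P, hP, hle⟩ := b.exists_comap_le_associatedPrime hQ
    obtain ⟨s, hs, hsx⟩ := hx P hP
    refine ⟨algebraMap A B s, fun h => hs (hle h), ?_⟩
    rw [← map_mul, ← Ideal.map_pow]
    exact Ideal.mem_map_of_mem _ hsx

end Free

/-! ### Dimension of the quotient by a regular sequence. -/

open RingTheory.Sequence in
theorem supportDim_quotient_add_length_le {R M : Type*} [CommRing R] [IsNoetherianRing R]
    [AddCommGroup M] [Module R M] [Module.Finite R M] (rs : List R) (h : IsWeaklyRegular M rs) :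
    Module.supportDim R (M ⧸ Ideal.ofList rs • (⊤ : Submodule R M)) + rs.length ≤
      Module.supportDim R M := by
  induction rs generalizing M with
  | nil =>
    rw [Ideal.ofList_nil, Submodule.bot_smul]
    simpa using (Module.supportDim_eq_of_equiv (Submodule.quotEquivOfEqBot ⊥ rfl)).le
  | cons x rs ih =>
    rw [isWeaklyRegular_cons_iff] at h
    rw [Module.supportDim_eq_of_equiv
      (Submodule.quotOfListConsSMulTopEquivQuotSMulTopInner M x rs)]
    refine le_trans ?_ (Module.supportDim_quotSMulTop_succ_le_of_notMem_minimalPrimes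
      (x := x) (fun _ => h.1.notMem_of_mem_minimalPrimes))
    refine le_trans (le_of_eq ?_) (add_le_add_left (ih h.2) 1)
    simp [add_assoc]

open RingTheory.Sequence in
theorem ringKrullDim_quotient_add_length_le {R : Type*} [CommRing R] [IsNoetherianRing R]
    (rs : List R) (h : IsWeaklyRegular R rs) :
    ringKrullDim (R ⧸ Ideal.ofList rs) + rs.length ≤ ringKrullDim R := by
  have := supportDim_quotient_add_length_le rs h
  rwa [Module.supportDim_self_eq_ringKrullDim, smul_eq_mul, Ideal.mul_top,
    Module.supportDim_quotient_eq_ringKrullDim] at this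

/-- A polynomial ring modulo a weakly regular sequence with as many terms as variables is
finite-dimensional. -/
theorem finite_quotient_of_isWeaklyRegular {k : Type*} [Field k] {n : ℕ}
    (rs : List (MvPolynomial (Fin n) k)) (hrs : rs.length = n)
    (h : RingTheory.Sequence.IsWeaklyRegular (MvPolynomial (Fin n) k) rs) :
    Module.Finite k (MvPolynomial (Fin n) k ⧸ Ideal.ofList rs) := by
  rw [Module.finite_iff_krullDimLE_zero, Ring.krullDimLE_iff]
  have := ringKrullDim_quotient_add_length_le rs h
  rw [MvPolynomial.ringKrullDim_of_isNoetherianRing, hrs, Nat.card_fin] at this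
  rw [ringKrullDim_eq_zero_of_field k] at this
  change ringKrullDim (MvPolynomial (Fin n) k ⧸ Ideal.ofList rs) ≤ ((0 : ℕ) : WithBot ℕ∞)
  generalize ringKrullDim (MvPolynomial (Fin n) k ⧸ Ideal.ofList rs) = x at this ⊢
  induction x using WithBot.recBotCoe with
  | bot => simp
  | coe x =>
    induction x using ENat.recTopCoe with
    | top =>
      exfalso
      rw [zero_add] at this
      have h2 : ((⊤ : ℕ∞) + n : ℕ∞) ≤ n := by exact_mod_cast this
      simp at h2
    | coe x =>
      have h2 : x + n ≤ 0 + n := by exact_mod_cast this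
      have : x = 0 := by omega
      simp [this]

/-! ### Independence over the polynomial ring acting through a regular sequence. -/

namespace MvPolynomial

variable {k : Type*} [Field k]

theorem X_zero_dvd_sub_rename {n : ℕ} (p : MvPolynomial (Fin (n + 1)) k) :
    X 0 ∣ p - rename Fin.succ (aeval (Fin.cons 0 X : Fin (n + 1) → MvPolynomial (Fin n) k) p) := by
  rw [← Ideal.mem_span_singleton, ← Ideal.Quotient.mk_eq_mk_iff_sub_mem]
  have : Ideal.Quotient.mkₐ k (Ideal.span {(X 0 : MvPolynomial (Fin (n + 1)) k)}) =
      (Ideal.Quotient.mkₐ k _).comp ((rename Fin.succ).comp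
        (aeval (Fin.cons 0 X : Fin (n + 1) → MvPolynomial (Fin n) k))) := by
    refine algHom_ext fun i => ?_
    refine Fin.cases ?_ (fun i => ?_) i
    · simp
    · simp
  exact DFunLike.congr_fun this p

theorem eq_zero_of_forall_X_pow_dvd {σ : Type*} {i : σ} {p : MvPolynomial σ k}
    (h : ∀ N, X i ^ N ∣ p) : p = 0 := by
  by_contra hp
  have hu : ¬ IsUnit (X i : MvPolynomial σ k) := X_prime.not_isUnit
  obtain ⟨N, hN⟩ := FiniteMultiplicity.of_not_isUnit hu hp
  exact hN (h _)

open RingTheory.Sequence in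
/-- Elements that are independent modulo a weakly regular sequence `f` are independent over the
polynomial ring acting through `f`. -/
theorem eq_zero_of_sum_aeval_smul_eq_zero {R ι : Type*} [CommRing R] [Algebra k R] {n : ℕ}
    {M : Type*} [AddCommGroup M] [Module R M]
    (f : Fin n → R) (hf : IsWeaklyRegular M (List.ofFn f)) (e : ι → M)
    (he : ∀ c : ι →₀ k, (c.sum fun i a => algebraMap k R a • e i) ∈
      (Ideal.ofList (List.ofFn f) • ⊤ : Submodule R M) → c = 0)
    (s : ι →₀ MvPolynomial (Fin n) k) (hs : (s.sum fun i p => aeval f p • e i) = 0) : s = 0 := by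
  induction n generalizing M with
  | zero =>
    have hC : ∀ p : MvPolynomial (Fin 0) k, p = C (constantCoeff p) := fun p =>
      eq_C_of_isEmpty p
    have h0 := he (s.mapRange constantCoeff (map_zero _)) (by
      rw [Finsupp.sum_mapRange_index (by simp)]
      convert Submodule.zero_mem _
      rw [← hs]
      refine Finsupp.sum_congr fun i _ => ?_
      conv_rhs => rw [hC (s i), aeval_C])
    ext1 i
    rw [hC (s i)]
    have := DFunLike.congr_fun h0 i
    simp only [Finsupp.mapRange_apply, Finsupp.coe_zero, Pi.zero_apply] at this
    simp [this]
  | succ n ih =>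
    rw [List.ofFn_succ, isWeaklyRegular_cons_iff] at hf
    set g : Fin n → R := fun i => f i.succ with hg
    -- Modulo `f 0`, a relation becomes one over `n` variables acting through the remaining `f i`;
    -- by induction its coefficients vanish there, so the original ones are divisible by `X 0`.
    have key : ∀ t : ι →₀ MvPolynomial (Fin (n + 1)) k, (t.sum fun i p => aeval f p • e i) = 0 →
        ∀ i, X 0 ∣ t i := by
      intro t ht
      set π : MvPolynomial (Fin (n + 1)) k →ₐ[k] MvPolynomial (Fin n) k :=
        aeval (Fin.cons 0 X : Fin (n + 1) → MvPolynomial (Fin n) k) with hπ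
      let q : M →ₗ[R] QuotSMulTop (f 0) M := Submodule.mkQ _
      have hq0 : ∀ m, q (f 0 • m) = 0 := fun m =>
        (Submodule.Quotient.mk_eq_zero _).2 (Submodule.smul_mem_pointwise_smul _ _ _ trivial)
      have hπq : ∀ p m, q (aeval f p • m) = aeval g (π p) • q m := by
        intro p m
        obtain ⟨r, hr⟩ := X_zero_dvd_sub_rename p
        have : aeval f p = f 0 * aeval f r + aeval g (π p) := by
          conv_lhs => rw [sub_eq_iff_eq_add.1 hr, map_add, map_mul, aeval_X, aeval_rename]
          rfl
        rw [this, add_smul, mul_smul, map_add, hq0, zero_add, map_smul]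
      have := ih g hf.2 (q ∘ e) (fun c hc => he c ?_) (t.mapRange π (map_zero _)) ?_
      · intro i
        have h1 := DFunLike.congr_fun this i
        simp only [Finsupp.mapRange_apply, Finsupp.coe_zero, Pi.zero_apply] at h1
        have h2 := X_zero_dvd_sub_rename (t i)
        rwa [← hπ, h1, map_zero, sub_zero] at h2
      · rw [List.ofFn_succ, Ideal.ofList_cons_smul]
        have : (c.sum fun i a => algebraMap k R a • (q ∘ e) i) =
            q (c.sum fun i a => algebraMap k R a • e i) := by
          simp [Finsupp.sum]
        rw [this] at hc
        have h1 : (Ideal.ofList (List.ofFn g) • ⊤ : Submodule R (QuotSMulTop (f 0) M)) =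
            (Ideal.ofList (List.ofFn g) • ⊤ : Submodule R M).map q := by
          rw [Submodule.map_smul'', Submodule.map_top, Submodule.range_mkQ]
        rw [h1, ← Submodule.mem_comap, Submodule.comap_map_eq, Submodule.ker_mkQ, sup_comm] at hc
        exact hc
      · rw [Finsupp.sum_mapRange_index (by simp)]
        have := congrArg q ht
        rw [map_zero, Finsupp.sum, map_sum] at this
        rw [← this]
        exact Finset.sum_congr rfl fun i _ => (hπq _ _).symm
    -- Since `f 0` is a nonzerodivisor on `M`, a relation divided by `X 0` is again a relation, so
    -- the divisibility can be iterated.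
    have hdvd : ∀ N, ∀ t : ι →₀ MvPolynomial (Fin (n + 1)) k,
        (t.sum fun i p => aeval f p • e i) = 0 → ∀ i, X 0 ^ N ∣ t i := by
      intro N
      induction N with
      | zero => simp
      | succ N ihN =>
        intro t ht
        have hdiv : ∀ i, t i = X 0 * (t i).divMonomial (Finsupp.single 0 1) := by
          intro i
          obtain ⟨r, hr⟩ := key t ht i
          conv_rhs => rw [hr, X_mul_divMonomial]
          exact hr
        have := ihN (t.mapRange (fun p => p.divMonomial (Finsupp.single 0 1))
          (zero_divMonomial _)) (by
            apply hf.1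
            simp only [smul_zero]
            rw [Finsupp.sum_mapRange_index (by simp), Finsupp.smul_sum, ← ht]
            refine Finset.sum_congr rfl fun i _ => ?_
            conv_rhs =>
              beta_reduce
              rw [hdiv i, map_mul, aeval_X, mul_smul])
        intro i
        rw [hdiv i, pow_succ']
        exact mul_dvd_mul_left _ (this i)
    ext1 i
    exact eq_zero_of_forall_X_pow_dvd fun N => hdvd N s hs i

end MvPolynomial

/-! ### Generation by forms, and the resulting basis. -/

namespace MvPolynomial

variable {k : Type*} [Field k]

theorem homogeneousComponent_mul_of_isHomogeneous {σ : Type*} {d : ℕ} (p : MvPolynomial σ k)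
    {q : MvPolynomial σ k} (hq : q.IsHomogeneous d) (D : ℕ) :
    homogeneousComponent D (p * q) = if d ≤ D then homogeneousComponent (D - d) p * q else 0 := by
  classical
  have h := DirectSum.coe_decompose_mul_of_right_mem (homogeneousSubmodule σ k) (a := p) D
    ((mem_homogeneousSubmodule _ _).2 hq)
  simpa only [DirectSum.decompose, Equiv.coe_fn_mk, decomposition.decompose'_apply] using! h

/-- The ideal of a regular sequence of forms of the same degree `d` is proper, so `d ≠ 0`. -/
theorem degree_ne_zero_of_isRegular {σ : Type*} {n d : ℕ} {f : Fin (n + 1) → MvPolynomial σ k}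
    (hf : ∀ i, (f i).IsHomogeneous d)
    (hreg : RingTheory.Sequence.IsRegular (MvPolynomial σ k) (List.ofFn f)) : d ≠ 0 := by
  rintro rfl
  have h0 : f 0 = C (constantCoeff (f 0)) := by
    exact totalDegree_eq_zero_iff_eq_C.1 (Nat.le_zero.1 (hf 0).totalDegree_le)
  have hne : f 0 ≠ 0 := by
    intro h
    have h1 := hreg.toIsWeaklyRegular
    rw [List.ofFn_succ, RingTheory.Sequence.isWeaklyRegular_cons_iff, h] at h1
    exact one_ne_zero (h1.1 (show (0 : MvPolynomial σ k) • (1 : MvPolynomial σ k) = 0 • 0 by simp))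
  have hu : IsUnit (f 0) := by
    rw [h0] at hne ⊢
    exact (IsUnit.mk0 _ fun h => hne (by rw [h, C_0])).map C
  apply hreg.top_ne_smul
  rw [smul_eq_mul, Ideal.mul_top, eq_comm]
  exact Ideal.eq_top_of_isUnit_mem _ (Ideal.subset_span (by simp)) hu

variable {n d : ℕ}

theorem ofList_ofFn {R : Type*} [CommRing R] (f : Fin n → R) :
    Ideal.ofList (List.ofFn f) = Ideal.span (Set.range f) := by
  rw [Ideal.ofList]
  congr 1
  ext
  simp [List.mem_ofFn]

/-- Graded Nakayama lemma: forms spanning the quotient by `f` generate the polynomial ring over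
the polynomial ring acting through `f`. -/
theorem exists_sum_aeval_mul_eq {σ κ : Type*} (hd : d ≠ 0)
    {f : Fin n → MvPolynomial σ k} (hf : ∀ i, (f i).IsHomogeneous d)
    (e : κ → MvPolynomial σ k) (δ : κ → ℕ) (he : ∀ j, (e j).IsHomogeneous (δ j))
    (hspan : ∀ x, ∃ c : κ →₀ k, x - (c.sum fun j a => a • e j) ∈ Ideal.span (Set.range f))
    (x : MvPolynomial σ k) :
    ∃ s : κ →₀ MvPolynomial (Fin n) k, (s.sum fun j p => aeval f p * e j) = x := by
  classical
  let E : (κ →₀ MvPolynomial (Fin n) k) →+ MvPolynomial σ k := Finsupp.liftAddHom fun j =>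
    (AddMonoidHom.mulRight (e j)).comp ((aeval f : MvPolynomial (Fin n) k →ₐ[k] MvPolynomial σ k) :
      MvPolynomial (Fin n) k →+ MvPolynomial σ k)
  have hE : ∀ s, E s = s.sum fun j p => aeval f p * e j := fun s => rfl
  have hmul : ∀ (p : MvPolynomial (Fin n) k) (x : MvPolynomial σ k), x ∈ E.range → aeval f p * x ∈ E.range := by
    rintro p _ ⟨s, rfl⟩
    refine ⟨s.mapRange (p * ·) (mul_zero _), ?_⟩
    rw [hE, hE, Finsupp.sum_mapRange_index (by simp), Finsupp.mul_sum]
    simp [mul_assoc]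
  have hmem : ∀ j, e j ∈ E.range := fun j => ⟨Finsupp.single j 1, by simp [hE]⟩
  have hsmul : ∀ (a : k) x, x ∈ E.range → a • x ∈ E.range := fun a x hx => by
    simpa [algebraMap_eq, C_mul'] using hmul (C a) x hx
  suffices h : ∀ D x, homogeneousComponent D x ∈ E.range by
    have : x ∈ E.range := by
      rw [← sum_homogeneousComponent x]
      exact AddSubgroup.sum_mem _ fun D _ => h D x
    exact this
  intro D
  induction D using Nat.strong_induction_on with
  | _ D ih =>
    intro x
    obtain ⟨c, hc⟩ := hspan x
    obtain ⟨h, hh⟩ := Ideal.mem_span_range_iff_exists_fun.1 hc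
    rw [eq_sub_iff_add_eq] at hh
    -- In degree `D` the coefficient of `f i` contributes only its component of degree `D - d`,
    -- which is below `D` because `d ≠ 0`.
    rw [← hh, map_add, map_sum, Finsupp.sum, map_sum]
    refine AddSubgroup.add_mem _ (AddSubgroup.sum_mem _ fun i _ => ?_)
      (AddSubgroup.sum_mem _ fun j _ => ?_)
    · rw [homogeneousComponent_mul_of_isHomogeneous _ (hf i)]
      split_ifs with hdD
      · have := hmul (X i) _ (ih (D - d) (by omega) (h i))
        rwa [aeval_X, mul_comm] at this
      · exact AddSubgroup.zero_mem _
    · rw [map_smul]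
      apply hsmul
      rw [homogeneousComponent_of_mem ((mem_homogeneousSubmodule _ _).2 (he j))]
      split_ifs
      · exact hmem j
      · exact AddSubgroup.zero_mem _

/-- A polynomial ring is finite free over the subalgebra generated by a maximal regular sequence
of forms of the same degree, which is itself a polynomial ring. -/
theorem exists_basis_of_isRegular {f : Fin (n + 1) → MvPolynomial (Fin (n + 1)) k}
    (hf : ∀ i, (f i).IsHomogeneous d)
    (hreg : RingTheory.Sequence.IsRegular (MvPolynomial (Fin (n + 1)) k) (List.ofFn f)) :
    ∃ (κ : Type) (_ : Finite κ) (_ : Nonempty κ) (e : κ → MvPolynomial (Fin (n + 1)) k),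
      (∀ s : κ →₀ MvPolynomial (Fin (n + 1)) k, (s.sum fun j p => aeval f p * e j) = 0 → s = 0) ∧
      ∀ x, ∃ s : κ →₀ MvPolynomial (Fin (n + 1)) k, (s.sum fun j p => aeval f p * e j) = x := by
  set J := Ideal.ofList (List.ofFn f) with hJ
  let q := Ideal.Quotient.mkₐ k J
  have hq : Function.Surjective q := Ideal.Quotient.mkₐ_surjective k J
  have hq0 : ∀ x, q x = 0 ↔ x ∈ J := fun x => Ideal.Quotient.eq_zero_iff_mem
  have hfin : Module.Finite k (MvPolynomial (Fin (n + 1)) k ⧸ J) :=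
    finite_quotient_of_isWeaklyRegular _ (by simp) hreg.toIsWeaklyRegular
  -- The basis of the quotient is chosen among monomials so that its lifts are homogeneous, as
  -- graded Nakayama requires.
  obtain ⟨κ, a, -, hsp, hli⟩ := exists_linearIndependent' (K := k)
    (fun m : Fin (n + 1) →₀ ℕ => q (monomial m 1))
  set e : κ → MvPolynomial (Fin (n + 1)) k := fun j => monomial (a j) 1 with he
  have hsum : ∀ c : κ →₀ k, q (c.sum fun j t => t • e j) =
      Finsupp.linearCombination k ((fun m => q (monomial m 1)) ∘ a) c := by
    intro c
    simp [Finsupp.linearCombination_apply, Finsupp.sum, he]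
  have hκ : Finite κ := hli.finite
  have htop : Submodule.span k (Set.range fun m : Fin (n + 1) →₀ ℕ => q (monomial m 1)) = ⊤ := by
    have h1 : Submodule.span k (Set.range fun m : Fin (n + 1) →₀ ℕ =>
        (monomial m (1 : k))) = ⊤ := by
      simpa using (basisMonomials (Fin (n + 1)) k).span_eq
    have h2 := congrArg (Submodule.map q.toLinearMap) h1
    rw [Submodule.map_span, ← Set.range_comp, Submodule.map_top, LinearMap.range_eq_top.2 hq] at h2
    exact h2
  have hspan : ∀ x, ∃ c : κ →₀ k, x - (c.sum fun j a => a • e j) ∈ J := by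
    intro x
    have hx : q x ∈ Submodule.span k (Set.range ((fun m => q (monomial m 1)) ∘ a)) := by
      rw [hsp, htop]; trivial
    obtain ⟨c, hc⟩ := (Finsupp.mem_span_range_iff_exists_finsupp).1 hx
    refine ⟨c, ?_⟩
    rw [← hq0, map_sub, hsum, Finsupp.linearCombination_apply, hc, sub_self]
  have hne : Nonempty κ := by
    by_contra hempty
    rw [not_nonempty_iff] at hempty
    apply hreg.top_ne_smul
    rw [smul_eq_mul, Ideal.mul_top, eq_comm, Ideal.eq_top_iff_one]
    obtain ⟨c, hc⟩ := hspan 1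
    rwa [Subsingleton.elim c 0, Finsupp.sum_zero_index, sub_zero] at hc
  refine ⟨κ, hκ, hne, e, fun s hs => ?_, fun x => ?_⟩
  · refine eq_zero_of_sum_aeval_smul_eq_zero f hreg.toIsWeaklyRegular e (fun c hc => ?_) s hs
    rw [smul_eq_mul, Ideal.mul_top, ← hJ, ← hq0] at hc
    refine linearIndependent_iff.1 hli c ?_
    rw [← hsum, ← hc]
    simp [Finsupp.sum, algebraMap_eq, C_mul']
  · exact exists_sum_aeval_mul_eq (degree_ne_zero_of_isRegular hf hreg) hf e
      (fun j => (a j).degree) (fun j => isHomogeneous_monomial _ rfl)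
      (by rwa [← ofList_ofFn]) x

end MvPolynomial

/-- A ring homomorphism `A → B` is finite free if it makes `B` a nonzero finite free `A`-module. -/
def RingHom.IsFiniteFree {A B : Type*} [CommRing A] [CommRing B] (φ : A →+* B) : Prop :=
  letI := φ.toAlgebra
  ∃ κ : Type, _root_.Finite κ ∧ Nonempty κ ∧ Nonempty (Module.Basis κ A B)

/-! ### Consequences of finite freeness. -/

namespace RingHom.IsFiniteFree

variable {A B : Type*} [CommRing A] [CommRing B] {φ : A →+* B}

theorem of_sum_mul {κ : Type} [_root_.Finite κ] [Nonempty κ]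
    (e : κ → B) (hli : ∀ s : κ →₀ A, (s.sum fun j p => φ p * e j) = 0 → s = 0)
    (hspan : ∀ x, ∃ s : κ →₀ A, (s.sum fun j p => φ p * e j) = x) : φ.IsFiniteFree := by
  let := φ.toAlgebra
  refine ⟨κ, inferInstance, inferInstance,
    ⟨Module.Basis.mk (v := e) (linearIndependent_iff.2 hli) fun x _ => ?_⟩⟩
  rw [Finsupp.mem_span_range_iff_exists_finsupp]
  exact hspan x

/-- Coordinates in a form that mentions no algebra structure; the factor `a` serves conductor and
saturation arguments. -/
theorem exists_coords (h : φ.IsFiniteFree) (x : B) : ∃ (κ : Type) (c : κ → A),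
    ∀ (J : Ideal A) (a : A), φ a * x ∈ J.map φ ↔ ∀ i, a * c i ∈ J := by
  let := φ.toAlgebra
  obtain ⟨κ, _, _, ⟨b⟩⟩ := h
  exact ⟨κ, b.repr x, fun J a => b.algebraMap_mul_mem_ideal_map_iff⟩

theorem comap_map (h : φ.IsFiniteFree) (I : Ideal A) : (I.map φ).comap φ = I := by
  let := φ.toAlgebra
  obtain ⟨κ, _, ⟨i⟩, ⟨b⟩⟩ := h
  refine le_antisymm (fun a ha => ?_) Ideal.le_comap_map
  have h1 : algebraMap A B a * b i ∈ I.map (algebraMap A B) := Ideal.mul_mem_right _ _ ha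
  rw [b.algebraMap_mul_mem_ideal_map_iff] at h1
  simpa using h1 i

theorem map_le_map_iff (h : φ.IsFiniteFree) {I J : Ideal A} : I.map φ ≤ J.map φ ↔ I ≤ J := by
  rw [Ideal.map_le_iff_le_comap, h.comap_map]

theorem isIntegral (h : φ.IsFiniteFree) : φ.IsIntegral := by
  let := φ.toAlgebra
  obtain ⟨κ, _, _, ⟨b⟩⟩ := h
  have := Module.Finite.of_basis b
  exact (Algebra.IsIntegral.of_finite A B).isIntegral

theorem symbolicPower_map [IsNoetherianRing A] [IsNoetherianRing B] (h : φ.IsFiniteFree)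
    (I : Ideal A) (m : ℕ) : symbolicPower (I.map φ) m = (symbolicPower I m).map φ := by
  have hint := h.isIntegral
  let := φ.toAlgebra
  obtain ⟨κ, _, _, ⟨b⟩⟩ := h
  have : Algebra.IsIntegral A B := ⟨hint⟩
  exact b.symbolicPower_map I m

theorem symbolicPower_map_le_pow_iff [IsNoetherianRing A] [IsNoetherianRing B]
    (h : φ.IsFiniteFree) (I : Ideal A) (m r : ℕ) :
    symbolicPower (I.map φ) m ≤ I.map φ ^ r ↔ symbolicPower I m ≤ I ^ r := by
  rw [h.symbolicPower_map, ← Ideal.map_pow, h.map_le_map_iff]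

theorem exists_prime_comap_eq (h : φ.IsFiniteFree) (P : Ideal A) [P.IsPrime] :
    ∃ Q : Ideal B, Q.IsPrime ∧ Q.comap φ = P := by
  have hint := h.isIntegral
  have hcm := h.comap_map
  let := φ.toAlgebra
  have : Algebra.IsIntegral A B := ⟨hint⟩
  obtain ⟨Q, -, hQ, hQP⟩ := Ideal.exists_ideal_over_prime_of_isIntegral P (P.map (algebraMap A B))
    (hcm P).le
  exact ⟨Q, hQ, hQP⟩

theorem eq_of_comap_le (h : φ.IsFiniteFree) {Q Q' : Ideal B} [Q.IsPrime] (hle : Q ≤ Q')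
    (hc : Q'.comap φ ≤ Q.comap φ) : Q = Q' := by
  have hint := h.isIntegral
  let := φ.toAlgebra
  have : Algebra.IsIntegral A B := ⟨hint⟩
  by_contra hne
  exact (Ideal.IsIntegral.comap_lt_comap (R := A) (lt_of_le_of_ne hle hne)).not_ge hc

end RingHom.IsFiniteFree

/-- Quasi-sobriety makes every irreducible closed set the closure of a point, so strict inclusions
of such sets are strict specializations. -/
theorem topologicalKrullDim_eq_zero_iff {X : Type*} [TopologicalSpace X] [QuasiSober X] :
    topologicalKrullDim X = 0 ↔ Nonempty X ∧ ∀ x y : X, x ⤳ y → y ⤳ x := by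
  rw [topologicalKrullDim, le_antisymm_iff, Order.krullDim_nonneg_iff, and_comm,
    Order.krullDim_nonpos_iff_forall_isMax]
  let cl : X → TopologicalSpace.IrreducibleCloseds X := fun x =>
    ⟨closure {x}, isIrreducible_singleton.closure, isClosed_closure⟩
  refine and_congr ⟨fun ⟨Z⟩ => Z.2.nonempty.to_type, fun ⟨x⟩ => ⟨cl x⟩⟩ ⟨fun H x y hxy => ?_,
    fun H Z Y hZY => ?_⟩
  · rw [specializes_iff_closure_subset] at hxy ⊢
    exact H (cl y) (show cl y ≤ cl x from hxy)
  · obtain ⟨z, hz⟩ := QuasiSober.sober Z.2 Z.3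
    obtain ⟨y, hy⟩ := QuasiSober.sober Y.2 Y.3
    have h1 : y ⤳ z := by
      rw [specializes_iff_mem_closure, hy.def]
      exact hZY (hz.mem)
    have h2 := (H _ _ h1).closure_subset
    rw [hy.def, hz.def] at h2
    exact h2

/-! ### Ideals of points under pushforward. -/

section Proj

open MvPolynomial

variable {k : Type*} [Field k] {n : ℕ}

theorem ProjectiveSpectrum.quasiSober {σ A : Type*} [CommRing A] [SetLike σ A]
    [AddSubgroupClass σ A] (𝒜 : ℕ → σ) [GradedRing 𝒜] : QuasiSober (ProjectiveSpectrum 𝒜) :=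
  inferInstanceAs (QuasiSober (AlgebraicGeometry.Proj 𝒜))

theorem MvPolynomial.mem_of_constantCoeff_eq_zero {σ : Type*} {P : Ideal (MvPolynomial σ k)}
    (h : ∀ i, X i ∈ P) {p : MvPolynomial σ k} (hp : constantCoeff p = 0) : p ∈ P := by
  have hle : Ideal.span (X '' Set.univ) ≤ P := Ideal.span_le.2 (by rintro _ ⟨i, -, rfl⟩; exact h i)
  refine hle (mem_ideal_span_X_image.2 fun m hm => ?_)
  by_contra! hne
  have : m = 0 := Finsupp.ext fun i => hne i trivial
  rw [mem_support_iff, this] at hm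
  exact hm hp

theorem irrelevant_le_iff {P : HomogeneousIdeal (stdGrading k n)} :
    HomogeneousIdeal.irrelevant (stdGrading k n) ≤ P ↔ ∀ i, X i ∈ P.toIdeal := by
  have hmem : ∀ p : CoordRing k n, p ∈ HomogeneousIdeal.irrelevant (stdGrading k n) ↔
      constantCoeff p = 0 := by
    intro p
    rw [HomogeneousIdeal.mem_irrelevant_iff, GradedRing.proj_apply]
    have : ((DirectSum.decompose (stdGrading k n) p 0 : stdGrading k n 0) : CoordRing k n) =
        homogeneousComponent 0 p := decomposition.decompose'_apply p 0
    rw [this, homogeneousComponent_zero]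
    simp [constantCoeff_eq]
  refine ⟨fun h i => h ((hmem _).2 (constantCoeff_X _ i)), fun h p hp => ?_⟩
  exact mem_of_constantCoeff_eq_zero h ((hmem p).1 hp)

/-- `V(I)` is zero-dimensional iff it is nonempty and has no strict specializations. -/
theorem hasZeroDimLocus_iff {I : Ideal (CoordRing k n)} :
    HasZeroDimLocus I ↔
      (∃ P : Ideal (CoordRing k n), P.IsHomogeneous (stdGrading k n) ∧ P.IsPrime ∧
        (∃ i, X i ∉ P) ∧ I ≤ P) ∧
      ∀ P P' : Ideal (CoordRing k n), P.IsHomogeneous (stdGrading k n) →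
        P'.IsHomogeneous (stdGrading k n) → P.IsPrime → P'.IsPrime → (∃ i, X i ∉ P') → I ≤ P →
        P ≤ P' → P = P' := by
  have := ProjectiveSpectrum.quasiSober (stdGrading k n)
  have : QuasiSober (ProjectiveSpectrum.zeroLocus (stdGrading k n) (I : Set (CoordRing k n))) :=
    (ProjectiveSpectrum.isClosed_zeroLocus _ _).isClosedEmbedding_subtypeVal.quasiSober
  rw [HasZeroDimLocus, topologicalKrullDim_eq_zero_iff]
  have hsp : ∀ x y : ProjectiveSpectrum.zeroLocus (stdGrading k n) (I : Set (CoordRing k n)),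
      x ⤳ y ↔ x.1.asHomogeneousIdeal ≤ y.1.asHomogeneousIdeal := by
    intro x y
    rw [← Topology.IsInducing.subtypeVal.specializes_iff, specializes_iff_mem_closure,
      ← ProjectiveSpectrum.le_iff_mem_closure]
    rfl
  refine and_congr ⟨?_, ?_⟩ ⟨?_, ?_⟩
  · rintro ⟨x, hx⟩
    have := x.not_irrelevant_le
    rw [irrelevant_le_iff] at this
    push Not at this
    exact ⟨x.asHomogeneousIdeal.toIdeal, x.asHomogeneousIdeal.isHomogeneous, x.isPrime, this, hx⟩
  · rintro ⟨P, hh, hp, hi, hI⟩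
    refine ⟨⟨⟨⟨P, hh⟩, hp, ?_⟩, hI⟩⟩
    rw [irrelevant_le_iff]
    push Not
    exact hi
  · rintro H P P' hh hh' hp hp' ⟨i, hi⟩ hI hle
    let x : ProjectiveSpectrum (stdGrading k n) :=
      ⟨⟨P, hh⟩, hp, fun h => hi (hle (irrelevant_le_iff.1 h i))⟩
    let y : ProjectiveSpectrum (stdGrading k n) :=
      ⟨⟨P', hh'⟩, hp', fun h => hi (irrelevant_le_iff.1 h i)⟩
    have := H ⟨x, hI⟩ ⟨y, hI.trans hle⟩ ((hsp _ _).2 hle)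
    exact le_antisymm hle ((hsp _ _).1 this)
  · intro H x y hxy
    rw [hsp] at hxy ⊢
    have := y.1.not_irrelevant_le
    rw [irrelevant_le_iff] at this
    push Not at this
    exact (H x.1.asHomogeneousIdeal.toIdeal y.1.asHomogeneousIdeal.toIdeal
      x.1.asHomogeneousIdeal.isHomogeneous y.1.asHomogeneousIdeal.isHomogeneous x.1.isPrime
      y.1.isPrime this x.2 hxy).ge

variable {d : ℕ} {f : Fin (n + 1) → CoordRing k n}

theorem isHomogeneous_stdGrading_iff {J : Ideal (CoordRing k n)} :
    J.IsHomogeneous (stdGrading k n) ↔ ∀ i, ∀ p ∈ J, homogeneousComponent i p ∈ J := by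
  have : ∀ (p : CoordRing k n) i, ((DirectSum.decompose (stdGrading k n) p i :
      stdGrading k n i) : CoordRing k n) = homogeneousComponent i p :=
    fun p i => decomposition.decompose'_apply p i
  refine forall_congr' fun i => ?_
  simp only [← this]

/-- Substitution multiplies degrees by `d`, and `d ≠ 0` keeps distinct degrees distinct. -/
theorem homogeneousComponent_aeval (hd : d ≠ 0) (hf : ∀ i, (f i).IsHomogeneous d)
    (i : ℕ) (p : CoordRing k n) :
    homogeneousComponent (d * i) (aeval f p) = aeval f (homogeneousComponent i p) := by
  have hh : ∀ j, (aeval f (homogeneousComponent j p)).IsHomogeneous (d * j) := fun j => by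
    simpa [mul_comm] using (homogeneousComponent_isHomogeneous j p).aeval f hf
  conv_lhs => rw [← sum_homogeneousComponent p]
  rw [map_sum, map_sum, Finset.sum_eq_single i]
  · rw [homogeneousComponent_of_mem (hh i), if_pos rfl]
  · intro j _ hj
    rw [homogeneousComponent_of_mem (hh j), if_neg]
    exact fun h => hj (Nat.eq_of_mul_eq_mul_left (Nat.pos_of_ne_zero hd) h).symm
  · intro hi
    rw [homogeneousComponent_eq_zero i p (by simpa using hi), map_zero, map_zero]

theorem isHomogeneous_comap_aeval (hd : d ≠ 0) (hf : ∀ i, (f i).IsHomogeneous d)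
    {Q : Ideal (CoordRing k n)} (hQ : Q.IsHomogeneous (stdGrading k n)) :
    (Q.comap (aeval (R := k) f).toRingHom).IsHomogeneous (stdGrading k n) := by
  rw [isHomogeneous_stdGrading_iff] at hQ ⊢
  intro i p hp
  have := hQ (d * i) _ hp
  change homogeneousComponent (d * i) (aeval f p) ∈ Q at this
  rwa [homogeneousComponent_aeval hd hf] at this

theorem isHomogeneous_map_aeval (hf : ∀ i, (f i).IsHomogeneous d)
    {I : Ideal (CoordRing k n)} (hI : I.IsHomogeneous (stdGrading k n)) :
    (I.map (aeval (R := k) f).toRingHom).IsHomogeneous (stdGrading k n) := by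
  obtain ⟨s, rfl⟩ := (Ideal.IsHomogeneous.iff_exists _ _).1 hI
  rw [Ideal.map_span]
  apply Ideal.homogeneous_span
  rintro _ ⟨_, ⟨⟨p, i, hp⟩, -, rfl⟩, rfl⟩
  exact ⟨_, ((mem_homogeneousSubmodule _ _).1 hp).aeval f hf⟩

theorem constantCoeff_eq_zero_of_isHomogeneous (hd : d ≠ 0) {p : CoordRing k n}
    (hp : p.IsHomogeneous d) : constantCoeff p = 0 := by
  rw [constantCoeff_eq]
  exact hp.coeff_eq_zero (by simpa using hd.symm)

theorem constantCoeff_aeval (hd : d ≠ 0) (hf : ∀ i, (f i).IsHomogeneous d)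
    (p : CoordRing k n) : constantCoeff (aeval f p) = constantCoeff p := by
  have : ((constantCoeff : CoordRing k n →+* k).comp (aeval (R := k) f).toRingHom) =
      constantCoeff := by
    refine ringHom_ext (fun a => ?_) fun i => ?_
    · simp
    · simp [constantCoeff_eq_zero_of_isHomogeneous hd (hf i)]
  exact DFunLike.congr_fun this p

/-- The `f i` have no constant term, so `φ` sends `𝔪^N` into `𝔪^N`. Hence `𝔪^N` multiplies each
coordinate of `g` into `I`, and saturation of `I` applies to the coordinates. -/
theorem IsSaturatedIdeal.map_aeval (hd : d ≠ 0) (hf : ∀ i, (f i).IsHomogeneous d)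
    (hfree : (aeval (R := k) f).toRingHom.IsFiniteFree)
    {I : Ideal (CoordRing k n)} (hI : IsSaturatedIdeal I) :
    IsSaturatedIdeal (I.map (aeval (R := k) f).toRingHom) := by
  intro N g hg
  obtain ⟨κ, c, hc⟩ := hfree.exists_coords g
  have hmap : (Ideal.span (Set.range (X (R := k) (σ := Fin (n + 1))))).map
      (aeval (R := k) f).toRingHom ≤ Ideal.span (Set.range X) := by
    rw [Ideal.map_span, Ideal.span_le]
    rintro _ ⟨_, ⟨i, rfl⟩, rfl⟩
    refine mem_of_constantCoeff_eq_zero (fun i => Ideal.subset_span (Set.mem_range_self i)) ?_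
    simpa using constantCoeff_eq_zero_of_isHomogeneous hd (hf i)
  have h1 := hc I 1
  rw [map_one, one_mul] at h1
  refine h1.2 fun i => ?_
  rw [one_mul]
  refine hI N _ fun a ha => (hc I a).1 (hg _ ?_) i
  have h2 := Ideal.mem_map_of_mem (aeval (R := k) f).toRingHom ha
  rw [Ideal.map_pow] at h2
  exact Ideal.pow_right_mono hmap N h2

theorem HasZeroDimLocus.map_aeval (hd : d ≠ 0) (hf : ∀ i, (f i).IsHomogeneous d)
    (hfree : (aeval (R := k) f).toRingHom.IsFiniteFree)
    {I : Ideal (CoordRing k n)} (hI : HasZeroDimLocus I) :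
    HasZeroDimLocus (I.map (aeval (R := k) f).toRingHom) := by
  rw [hasZeroDimLocus_iff] at hI ⊢
  obtain ⟨⟨P, hPh, hP, ⟨i, hi⟩, hIP⟩, hmin⟩ := hI
  constructor
  · obtain ⟨Q, hQ, hQP⟩ := hfree.exists_prime_comap_eq P
    -- The prime `Q` over `P` need not be homogeneous; its homogeneous core is prime and still
    -- contains the homogeneous ideal `PR`.
    have hcore : P.map (aeval (R := k) f).toRingHom ≤
        (Q.homogeneousCore (stdGrading k n)).toIdeal := by
      rw [← (isHomogeneous_map_aeval hf hPh).toIdeal_homogeneousCore_eq_self]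
      exact Ideal.homogeneousCore_mono _ (Ideal.map_le_iff_le_comap.2 hQP.ge)
    refine ⟨_, (Q.homogeneousCore (stdGrading k n)).isHomogeneous, hQ.homogeneousCore, ?_,
      (Ideal.map_mono hIP).trans hcore⟩
    by_contra! hall
    apply hi
    rw [← hQP]
    apply Ideal.toIdeal_homogeneousCore_le (stdGrading k n) Q
    refine mem_of_constantCoeff_eq_zero hall ?_
    simpa using constantCoeff_eq_zero_of_isHomogeneous hd (hf i)
  · rintro Q Q' hQh hQ'h hQ hQ' ⟨j, hj⟩ hIQ hle
    refine hfree.eq_of_comap_le hle (hmin _ _ (isHomogeneous_comap_aeval hd hf hQh)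
      (isHomogeneous_comap_aeval hd hf hQ'h) (hQ.comap _) (hQ'.comap _) ?_
      (Ideal.map_le_iff_le_comap.1 hIQ) (Ideal.comap_mono hle)).ge
    -- Otherwise `Q'` contains every `f i`. Being homogeneous and proper it lies in `𝔪`, and both
    -- contract to the irrelevant ideal of `S`, so incomparability forces `Q' = 𝔪`, contradicting `X
    -- j ∉ Q'`.
    by_contra! hall
    have hQ'M : Q' = RingHom.ker (constantCoeff : CoordRing k n →+* k) := by
      refine hfree.eq_of_comap_le (fun x hx => ?_) fun a ha => ?_
      · rw [RingHom.mem_ker]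
        by_contra hne
        have h0 := isHomogeneous_stdGrading_iff.1 hQ'h 0 x hx
        rw [homogeneousComponent_zero] at h0
        exact hQ'.ne_top (Ideal.eq_top_of_isUnit_mem _ h0 ((IsUnit.mk0 _ hne).map C))
      · refine mem_of_constantCoeff_eq_zero hall ?_
        rw [← constantCoeff_aeval hd hf]
        exact ha
    exact hj (hQ'M ▸ constantCoeff_X _ j)

theorem IsIdealOfPoints.map_aeval (hd : d ≠ 0) (hf : ∀ i, (f i).IsHomogeneous d)
    (hfree : (aeval (R := k) f).toRingHom.IsFiniteFree)
    {I : Ideal (CoordRing k n)} (hI : IsIdealOfPoints I) :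
    IsIdealOfPoints (I.map (aeval (R := k) f).toRingHom) :=
  ⟨isHomogeneous_map_aeval hf hI.homogeneous, hI.saturated.map_aeval hd hf hfree,
    hI.zeroDim.map_aeval hd hf hfree⟩

theorem isFiniteFree_aeval_of_isRegular (hf : ∀ i, (f i).IsHomogeneous d)
    (hreg : RingTheory.Sequence.IsRegular (CoordRing k n) (List.ofFn f)) :
    (aeval (R := k) f).toRingHom.IsFiniteFree := by
  obtain ⟨κ, _, _, e, hli, hspan⟩ := exists_basis_of_isRegular hf hreg
  exact .of_sum_mul e hli hspan

end Proj

theorem mainTheorem1 {k : Type*} [Field k] (n : ℕ)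
    (I : Ideal (CoordRing k n)) (hI : IsIdealOfPoints I)
    (d : ℕ) (f : Fin (n + 1) → CoordRing k n) (hf : ∀ i, (f i).IsHomogeneous d)
    (hreg : RingTheory.Sequence.IsRegular (CoordRing k n) (List.ofFn f)) :
    (∀ m r : ℕ, symbolicPower I m ≤ I ^ r ↔
      symbolicPower (pushIdeal f I) m ≤ pushIdeal f I ^ r) ∧
    (∀ r : ℕ, 1 ≤ r → ¬ symbolicPower I (n * r - n + 1) ≤ I ^ r →
      IsIdealOfPoints (pushIdeal f I) ∧
        ¬ symbolicPower (pushIdeal f I) (n * r - n + 1) ≤ pushIdeal f I ^ r) := by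
  have hd := MvPolynomial.degree_ne_zero_of_isRegular hf hreg
  have hfree := isFiniteFree_aeval_of_isRegular hf hreg
  have hpush : pushIdeal f I = I.map (MvPolynomial.aeval (R := k) f).toRingHom := rfl
  have h1 : ∀ m r : ℕ, symbolicPower I m ≤ I ^ r ↔
      symbolicPower (pushIdeal f I) m ≤ pushIdeal f I ^ r := fun m r => by
    rw [hpush, hfree.symbolicPower_map_le_pow_iff]
  refine ⟨h1, fun r _ hr => ⟨?_, fun h => hr ((h1 _ _).2 h)⟩⟩
  rw [hpush]
  exact hI.map_aeval hd hf hfree
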